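/- Let $\mathbb K$ be a field of characteristic zero, let $n\in\mathbb N$, let $u,v\in\mathbb Z_{>0}^n$ and $0\neq w\in\mathbb R_{\ge 0}^n$. Let $D_n$ be the $n$-th Weyl algebra over $\mathbb K$, with generators $x_1,\dots,x_n,\partial_1,\dots,\partial_n$ and relations $x_jx_i=x_ix_j$, $\partial_j\partial_i=\partial_i\partial_j$, $\partial_jx_i=x_i\partial_j+\delta_{ij}$, and let $D^{(h)}_{(u,v)}$ be the weighted homogenized Weyl algebra, i.e. the $\mathbb K$-algebra with generators $x_1,\dots,x_n,\partial_1,\dots,\partial_n,h$, in which $h$ is central, $x_jx_i=x_ix_j$, $\partial_j\partial_i=\partial_i\partial_j$ and $\partial_jx_i=x_i\partial_j+\delta_{ij}h^{u_i+v_j}$. The monomials $x^\alpha\partial^\beta$ (resp. $x^\alpha\partial^\beta h^k$) form a $\mathbb K$-basis of $D_n$ (resp. $D^{(h)}_{(u,v)}$); divisibility of monomials means componentwise comparison of exponents. For $p=\sum c_{\alpha\beta}x^\alpha\partial^\beta\in D_n$ put $H_{(u,v)}(p)=\sum c_{\alpha\beta}h^{\deg_{(u,v)}(p)-(u\alpha+v\beta)}x^\alpha\partial^\beta$,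 where $\deg_{(u,v)}(p)=\max\{u\alpha+v\beta\mid c_{\alpha\beta}\ne0\}$ (and $H_{(u,v)}(0)=0$). For a left ideal $I\subseteq D_n$ let $H_{(u,v)}(I)$ denote the left ideal of $D^{(h)}_{(u,v)}$ generated by all $H_{(u,v)}(p)$, $p\in I$. For $f\in D^{(h)}_{(u,v)}$ let $\mathrm{in}_{(-w,w,0)}(f)$ be the sum of those terms $c\,x^\alpha\partial^\beta h^k$ of $f$ for which $-w\alpha+w\beta$ is maximal (and $\mathrm{in}_{(-w,w,0)}(0)=0$); for a left ideal $J$ let $\mathrm{in}_{(-w,w,0)}(J)$ be the $\mathbb K$-linear span of $\{\mathrm{in}_{(-w,w,0)}(f)\mid f\in J\}$, which is again a left ideal. Let $\prec$ be a global monomial ordering on $D_n$. Define $x^\alpha\partial^\beta\prec_{(-w,w)}x^\gamma\partial^\delta$ if $-w\alpha+w\beta<-w\gamma+w\delta$, or if equality holds and $x^\alpha\partial^\beta\prec x^\gamma\partial^\delta$. For an ordering $\lhd$ on the monomials of $D_n$ define its homogenization by $x^\alpha\partial^\beta h^k\mathrel{\lhd^{(h)}}x^\gamma\partial^\delta h^l$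 if $u\alpha+v\beta+k<u\gamma+v\delta+l$, or if equality holds and $x^\alpha\partial^\beta\lhd x^\gamma\partial^\delta$. A left Gröbner basis of a left ideal $J$ with respect to an ordering is a subset $G\subseteq J$ such that the leading monomial of every non-zero element of $J$ is divisible by the leading monomial of some non-zero element of $G$. An element of $D^{(h)}_{(u,v)}$ is called weighted homogeneous if all its monomials $x^\alpha\partial^\beta h^k$ have the same weighted degree $u\alpha+v\beta+k$. **Theorem.** Let $I\subseteq D_n$ be a left ideal and let $G^{(h)}$ be a left Gröbner basis of $H_{(u,v)}(I)$ with respect to $\prec_{(-w,w)}^{(h)}$ consisting of weighted homogeneous elements. Then $\{\mathrm{in}_{(-w,w,0)}(g)\mid g\in G^{(h)}\}$ is a left Gröbner basis of $\mathrm{in}_{(-w,w,0)}(H_{(u,v)}(I))$ with respect to $\prec^{(h)}$. -/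

import Mathlib

open Finsupp

/-! ## Monomials -/

/-- Exponents of the monomials `x^α ∂^β` of the `n`-th Weyl algebra:
`m (Sum.inl i) = α_i` and `m (Sum.inr i) = β_i`. -/
abbrev WMon (n : ℕ) : Type := (Fin n ⊕ Fin n) →₀ ℕ

/-- Exponents of the monomials `x^α ∂^β h^k`: the pair `((α, β), k)`.
Divisibility of (commutative) monomials is the order `≤`. -/
abbrev HMon (n : ℕ) : Type := WMon n × ℕ

/-- The exponent of the single variable `x_i`. -/
noncomputable abbrev eX {n : ℕ} (i : Fin n) : WMon n := Finsupp.single (Sum.inl i) 1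

/-- The exponent of the single variable `∂_i`. -/
noncomputable abbrev eD {n : ℕ} (i : Fin n) : WMon n := Finsupp.single (Sum.inr i) 1

/-! ## The Weyl algebra and the weighted homogenized Weyl algebra, by generators and relations -/

/-- The defining relations of the Weyl algebra
(`Sum.inl i` is the generator `x_i`, `Sum.inr i` is the generator `∂_i`). -/
inductive WeylRel (K : Type*) [Field K] (n : ℕ) :
    FreeAlgebra K (Fin n ⊕ Fin n) → FreeAlgebra K (Fin n ⊕ Fin n) → Prop
  | xx (i j : Fin n) : WeylRel K n
      (FreeAlgebra.ι K (Sum.inl j) * FreeAlgebra.ι K (Sum.inl i))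
      (FreeAlgebra.ι K (Sum.inl i) * FreeAlgebra.ι K (Sum.inl j))
  | dd (i j : Fin n) : WeylRel K n
      (FreeAlgebra.ι K (Sum.inr j) * FreeAlgebra.ι K (Sum.inr i))
      (FreeAlgebra.ι K (Sum.inr i) * FreeAlgebra.ι K (Sum.inr j))
  | dx (i j : Fin n) : WeylRel K n
      (FreeAlgebra.ι K (Sum.inr j) * FreeAlgebra.ι K (Sum.inl i))
      (FreeAlgebra.ι K (Sum.inl i) * FreeAlgebra.ι K (Sum.inr j) + if i = j then 1 else 0)

/-- The `n`-th Weyl algebra `D_n` over `K`. -/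
def WeylAlgebra (K : Type*) [Field K] (n : ℕ) : Type _ := RingQuot (WeylRel K n)

noncomputable instance (K : Type*) [Field K] (n : ℕ) : Ring (WeylAlgebra K n) :=
  inferInstanceAs (Ring (RingQuot (WeylRel K n)))

noncomputable instance (K : Type*) [Field K] (n : ℕ) : Algebra K (WeylAlgebra K n) :=
  inferInstanceAs (Algebra K (RingQuot (WeylRel K n)))

/-- The defining relations of the weighted homogenized Weyl algebra with weights `u`, `v`
(`none` is the generator `h`, `some (Sum.inl i)` is `x_i`, `some (Sum.inr i)` is `∂_i`). -/
inductive HWeylRel (K : Type*) [Field K] {n : ℕ} (u v : Fin n → ℕ) :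
    FreeAlgebra K (Option (Fin n ⊕ Fin n)) → FreeAlgebra K (Option (Fin n ⊕ Fin n)) → Prop
  | xx (i j : Fin n) : HWeylRel K u v
      (FreeAlgebra.ι K (some (Sum.inl j)) * FreeAlgebra.ι K (some (Sum.inl i)))
      (FreeAlgebra.ι K (some (Sum.inl i)) * FreeAlgebra.ι K (some (Sum.inl j)))
  | dd (i j : Fin n) : HWeylRel K u v
      (FreeAlgebra.ι K (some (Sum.inr j)) * FreeAlgebra.ι K (some (Sum.inr i)))
      (FreeAlgebra.ι K (some (Sum.inr i)) * FreeAlgebra.ι K (some (Sum.inr j)))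
  | xh (i : Fin n) : HWeylRel K u v
      (FreeAlgebra.ι K (some (Sum.inl i)) * FreeAlgebra.ι K none)
      (FreeAlgebra.ι K none * FreeAlgebra.ι K (some (Sum.inl i)))
  | dh (i : Fin n) : HWeylRel K u v
      (FreeAlgebra.ι K (some (Sum.inr i)) * FreeAlgebra.ι K none)
      (FreeAlgebra.ι K none * FreeAlgebra.ι K (some (Sum.inr i)))
  | dx (i j : Fin n) : HWeylRel K u v
      (FreeAlgebra.ι K (some (Sum.inr j)) * FreeAlgebra.ι K (some (Sum.inl i)))
      (FreeAlgebra.ι K (some (Sum.inl i)) * FreeAlgebra.ι K (some (Sum.inr j)) +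
        if i = j then FreeAlgebra.ι K none ^ (u i + v j) else 0)

/-- The `n`-th weighted homogenized Weyl algebra with weights `u`, `v`. -/
def HWeylAlgebra (K : Type*) [Field K] {n : ℕ} (u v : Fin n → ℕ) : Type _ :=
  RingQuot (HWeylRel K u v)

noncomputable instance (K : Type*) [Field K] {n : ℕ} (u v : Fin n → ℕ) :
    Ring (HWeylAlgebra K u v) :=
  inferInstanceAs (Ring (RingQuot (HWeylRel K u v)))

noncomputable instance (K : Type*) [Field K] {n : ℕ} (u v : Fin n → ℕ) :
    Algebra K (HWeylAlgebra K u v) :=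
  inferInstanceAs (Algebra K (RingQuot (HWeylRel K u v)))

/-! ## Ordered products in an arbitrary ring -/

/-- The ordered product `x_1^{a_1} ⋯ x_n^{a_n}`. -/
def powProd {A : Type*} [Monoid A] {n : ℕ} (x : Fin n → A) (a : Fin n → ℕ) : A :=
  ((List.finRange n).map fun i => x i ^ a i).prod

theorem mul_listProd {A : Type*} [Ring A] {n : ℕ} (x : Fin n → A)
    (hx : ∀ i j, Commute (x i) (x j)) (i : Fin n) (a b : Fin n → ℕ)
    (hb : b i = a i + 1) (hb' : ∀ j, j ≠ i → b j = a j) (l : List (Fin n)) (hl : l.Nodup) :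
    (l.map fun j => x j ^ b j).prod =
      if i ∈ l then x i * (l.map fun j => x j ^ a j).prod
      else (l.map fun j => x j ^ a j).prod := by
  induction l with
  | nil => simp
  | cons j l ih =>
    have ih := ih (List.nodup_cons.1 hl).2
    have hj := (List.nodup_cons.1 hl).1
    simp only [List.map_cons, List.prod_cons, ih, List.mem_cons]
    by_cases hij : i = j
    · subst hij
      simp [hj, hb, pow_succ', mul_assoc]
    · by_cases hil : i ∈ l
      · simp only [hil, hij, or_true, if_true, hb' j (Ne.symm hij)]
        rw [← mul_assoc, ← mul_assoc, ((hx j i).pow_left (a j)).eq]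
      · simp [hil, hij, hb' j (Ne.symm hij)]

theorem mul_powProd {A : Type*} [Ring A] {n : ℕ} (x : Fin n → A)
    (hx : ∀ i j, Commute (x i) (x j)) (i : Fin n) (a b : Fin n → ℕ)
    (hb : b i = a i + 1) (hb' : ∀ j, j ≠ i → b j = a j) :
    powProd x b = x i * powProd x a := by
  have := mul_listProd x hx i a b hb hb' (List.finRange n) (List.nodup_finRange n)
  simpa [powProd] using this

theorem deriv_mul_pow {A : Type*} [Ring A] (x d q : A) (hd : d * x = x * d + q)
    (hq : Commute q x) (k : ℕ) :
    d * x ^ k = x ^ k * d + (k : A) * (q * x ^ (k - 1)) := by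
  induction k with
  | zero => simp
  | succ k ih =>
    have e : x ^ (k + 1) = x * x ^ k := pow_succ' x k
    rw [e, ← mul_assoc, hd, add_mul, mul_assoc, ih]
    have h1 : x * ((k : A) * (q * x ^ (k - 1))) = (k : A) * (q * x ^ k) := by
      rcases k with _ | k
      · simp
      · rw [← mul_assoc, ← (Nat.cast_commute (k + 1) x).eq, mul_assoc, ← mul_assoc x q,
          ← hq.eq, mul_assoc, Nat.add_sub_cancel, pow_succ']
    rw [mul_add, h1]
    push_cast
    noncomm_ring

theorem deriv_mul_listProd {A : Type*} [Ring A] {n : ℕ} (x : Fin n → A) (i : Fin n) (d q : A)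
    (hd : d * x i = x i * d + q) (hd' : ∀ j, j ≠ i → Commute d (x j))
    (hq : ∀ j, Commute q (x j)) (a b : Fin n → ℕ)
    (hb : b i = a i - 1) (hb' : ∀ j, j ≠ i → b j = a j) (l : List (Fin n)) (hl : l.Nodup) :
    d * (l.map fun j => x j ^ a j).prod = (l.map fun j => x j ^ a j).prod * d +
      if i ∈ l then (a i : A) * (q * (l.map fun j => x j ^ b j).prod) else 0 := by
  induction l with
  | nil => simp
  | cons j l ih =>
    have ih := ih (List.nodup_cons.1 hl).2
    have hj := (List.nodup_cons.1 hl).1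
    simp only [List.map_cons, List.prod_cons, List.mem_cons]
    by_cases hij : i = j
    · subst hij
      have hl' : (l.map fun j => x j ^ b j) = l.map fun j => x j ^ a j := by
        refine List.map_congr_left fun k hk => ?_
        rw [hb' k (fun h => hj (h ▸ hk))]
      rw [← mul_assoc, deriv_mul_pow (x i) d q hd (hq i), add_mul, mul_assoc, ih]
      simp only [hj, if_false, add_zero, true_or, if_true, hl', hb]
      simp only [mul_assoc]
    · rw [← mul_assoc, ((hd' j (Ne.symm hij)).pow_right (a j)).eq, mul_assoc, ih]
      by_cases hil : i ∈ l
      · simp only [hil, hij, or_true, if_true, hb' j (Ne.symm hij), mul_add]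
        rw [← mul_assoc, ← mul_assoc (x j ^ a j) (a i : A), ← (Nat.cast_commute (a i) _).eq,
          mul_assoc (a i : A), ← mul_assoc (x j ^ a j) q, ← ((hq j).pow_right (a j)).eq]
        simp only [mul_assoc]
      · simp [hil, hij, mul_assoc]

theorem deriv_mul_powProd {A : Type*} [Ring A] {n : ℕ} (x : Fin n → A) (i : Fin n) (d q : A)
    (hd : d * x i = x i * d + q) (hd' : ∀ j, j ≠ i → Commute d (x j))
    (hq : ∀ j, Commute q (x j)) (a b : Fin n → ℕ)
    (hb : b i = a i - 1) (hb' : ∀ j, j ≠ i → b j = a j) :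
    d * powProd x a = powProd x a * d + (a i : A) * (q * powProd x b) := by
  have := deriv_mul_listProd x i d q hd hd' hq a b hb hb' (List.finRange n)
    (List.nodup_finRange n)
  simpa [powProd] using this

/-- Evaluation of an ordered product of shift operators at a basis vector. -/
theorem powProd_apply_single {K : Type*} [Field K] {n : ℕ} {M : Type*} [AddCommMonoid M]
    (T : Fin n → Module.End K (M →₀ K)) (e : Fin n → M) (P : M → Prop)
    (hP : ∀ i m, P m → P (e i + m))
    (hT : ∀ i m, P m → T i (single m 1) = single (e i + m) 1) (a : Fin n → ℕ)
    (m : M) (hm : P m) :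
    powProd T a (single m 1) = single ((∑ i, a i • e i) + m) 1 := by
  have hPk : ∀ i (k : ℕ) m, P m → P (k • e i + m) := by
    intro i k
    induction k with
    | zero => simp
    | succ k ih =>
      intro m hm
      rw [succ_nsmul, add_assoc]
      exact ih _ (hP i m hm)
  have hp : ∀ i (k : ℕ) m, P m → (T i ^ k) (single m 1) = single (k • e i + m) 1 := by
    intro i k
    induction k with
    | zero => simp
    | succ k ih =>
      intro m hm
      rw [pow_succ, Module.End.mul_apply, hT i m hm, ih _ (hP i m hm), succ_nsmul, add_assoc]
  have key : ∀ l : List (Fin n), P ((l.map fun i => a i • e i).sum + m) ∧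
      (l.map fun i => T i ^ a i).prod (single m 1) =
        single ((l.map fun i => a i • e i).sum + m) 1 := by
    intro l
    induction l with
    | nil => simpa using hm
    | cons j l ih =>
      refine ⟨?_, ?_⟩
      · simpa [add_assoc] using hPk j (a j) _ ih.1
      · simp only [List.map_cons, List.prod_cons, List.sum_cons, Module.End.mul_apply, ih.2,
          hp j (a j) _ ih.1, add_assoc]
  have h2 := (key (List.finRange n)).2
  rwa [← List.ofFn_eq_map, ← List.ofFn_eq_map, List.sum_ofFn, List.ofFn_eq_map] at h2

theorem map_powProd {A B F : Type*} [Monoid A] [Monoid B] [FunLike F A B] [MonoidHomClass F A B]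
    (f : F) {n : ℕ} (x : Fin n → A) (a : Fin n → ℕ) :
    f (powProd x a) = powProd (fun i => f (x i)) a := by
  simp [powProd, map_list_prod, Function.comp_def]

theorem powProd_zero {A : Type*} [Monoid A] {n : ℕ} (x : Fin n → A) :
    powProd x (fun _ => 0) = 1 := by
  simp [powProd]

theorem wmon_eq_sum {n : ℕ} (m : WMon n) :
    (∑ i, m (Sum.inl i) • (eX i : WMon n)) + ∑ i, m (Sum.inr i) • (eD i : WMon n) = m := by
  ext k
  rcases k with k | k <;> simp [Finsupp.single_apply]

theorem wmon_eD_add_sub {n : ℕ} (m : WMon n) (i j : Fin n) :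
    eD j + (m - eX i) = eD j + m - eX i := by
  ext k
  rcases k with k | k <;> simp

theorem wmon_sub_sub {n : ℕ} (m : WMon n) (i j : Fin n) :
    m - eX i - eX j = m - eX j - eX i := by
  ext k
  simp only [Finsupp.tsub_apply]
  omega

theorem wmon_cast_mul_cast {K : Type*} [Field K] {n : ℕ} (m : WMon n) (i j : Fin n) :
    (m (Sum.inl i) : K) * ((m - eX i) (Sum.inl j) : ℕ) =
      (m (Sum.inl j) : K) * ((m - eX j) (Sum.inl i) : ℕ) := by
  by_cases hij : i = j
  · subst hij; rfl
  · have hji : j ≠ i := Ne.symm hij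
    simp [hij, hji, mul_comm]

theorem wmon_add_sub_self {n : ℕ} (m : WMon n) (i : Fin n) : eX i + m - eX i = m :=
  add_tsub_cancel_left _ _

theorem wmon_add_sub_cancel {n : ℕ} (m : WMon n) (i : Fin n) (h0 : m (Sum.inl i) ≠ 0) :
    eX i + (m - eX i) = m := by
  ext k
  rcases k with k | k
  · by_cases hk : i = k
    · subst hk
      simp
      omega
    · simp [hk]
  · simp

theorem wmon_add_sub_of_ne {n : ℕ} (m : WMon n) (i j : Fin n) (hij : i ≠ j) :
    eX i + m - eX j = eX i + (m - eX j) := by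
  ext k
  rcases k with k | k
  · by_cases hk : i = k
    · subst hk
      simp [Ne.symm hij]
    · simp [hk]
  · simp

/-! ## Normally ordered monomials form a basis of the Weyl algebra -/

namespace WeylAlgebra

variable {K : Type*} [Field K] {n : ℕ}

/-- The generator `x_i`. -/
noncomputable def x (i : Fin n) : WeylAlgebra K n :=
  RingQuot.mkAlgHom K (WeylRel K n) (FreeAlgebra.ι K (Sum.inl i))

/-- The generator `∂_i`. -/
noncomputable def d (i : Fin n) : WeylAlgebra K n :=
  RingQuot.mkAlgHom K (WeylRel K n) (FreeAlgebra.ι K (Sum.inr i))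

theorem x_comm (i j : Fin n) : Commute (x i : WeylAlgebra K n) (x j) := by
  have := RingQuot.mkAlgHom_rel K (WeylRel.xx (K := K) j i)
  simp only [map_mul] at this
  exact this

theorem d_comm (i j : Fin n) : Commute (d i : WeylAlgebra K n) (d j) := by
  have := RingQuot.mkAlgHom_rel K (WeylRel.dd (K := K) j i)
  simp only [map_mul] at this
  exact this

theorem d_mul_x (i j : Fin n) :
    (d j * x i : WeylAlgebra K n) = x i * d j + if i = j then 1 else 0 := by
  have := RingQuot.mkAlgHom_rel K (WeylRel.dx (K := K) i j)
  simp only [map_mul, map_add, apply_ite (RingQuot.mkAlgHom K (WeylRel K n)), map_one,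
    map_zero] at this
  exact this

/-- The normally ordered monomial `x^α ∂^β`. -/
noncomputable def monomial (m : WMon n) : WeylAlgebra K n :=
  powProd x (fun i => m (Sum.inl i)) * powProd d (fun i => m (Sum.inr i))

/-- The element `∑ c_{αβ} x^α ∂^β` with given coefficients. -/
noncomputable def ofCoeffs : (WMon n →₀ K) →ₗ[K] WeylAlgebra K n :=
  Finsupp.linearCombination K monomial

/-- Left multiplication by `x_i`, on coefficients. -/
noncomputable def xOp (i : Fin n) : Module.End K (WMon n →₀ K) :=
  Finsupp.linearCombination K fun m => single (eX i + m) 1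

/-- Left multiplication by `∂_i`, on coefficients. -/
noncomputable def dOp (i : Fin n) : Module.End K (WMon n →₀ K) :=
  Finsupp.linearCombination K fun m =>
    single (eD i + m) 1 + (m (Sum.inl i) : K) • single (m - eX i) 1

theorem xOp_single (i : Fin n) (m : WMon n) :
    xOp i (single m (1 : K)) = single (eX i + m) 1 := by
  simp [xOp]

theorem dOp_single (i : Fin n) (m : WMon n) :
    dOp i (single m (1 : K)) =
      single (eD i + m) 1 + (m (Sum.inl i) : K) • single (m - eX i) 1 := by
  simp [dOp]

theorem dOp_comm (i j : Fin n) (m : WMon n) :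
    dOp j (dOp i (single m (1 : K))) = dOp i (dOp j (single m (1 : K))) := by
  simp only [dOp_single, map_add, map_smul, wmon_eD_add_sub, smul_add, smul_smul,
    wmon_sub_sub m i j, wmon_cast_mul_cast m i j]
  simp only [Finsupp.add_apply, Finsupp.single_apply, reduceCtorEq, if_false, zero_add,
    add_left_comm (eD i) (eD j) m]
  abel

theorem dOp_xOp (i j : Fin n) (m : WMon n) :
    dOp j (xOp i (single m (1 : K))) =
      xOp i (dOp j (single m (1 : K))) + if i = j then single m 1 else 0 := by
  simp only [dOp_single, xOp_single, map_add, map_smul, add_left_comm (eD j) (eX i) m]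
  rw [add_assoc]
  congr 1
  by_cases hij : i = j
  · subst hij
    rw [if_pos rfl, wmon_add_sub_self]
    by_cases h0 : m (Sum.inl i) = 0
    · simp [h0]
    · rw [wmon_add_sub_cancel m i h0]
      simp [add_smul, add_comm]
  · simp [wmon_add_sub_of_ne m i j hij, hij]

/-- The representation of the Weyl algebra on coefficient families. -/
noncomputable def rep : WeylAlgebra K n →ₐ[K] Module.End K (WMon n →₀ K) :=
  RingQuot.liftAlgHom K (s := WeylRel K n)
    ⟨FreeAlgebra.lift K (Sum.elim xOp dOp), by
      intro a b hab
      cases hab with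
      | xx i j =>
        refine Finsupp.lhom_ext' fun m => LinearMap.ext_ring ?_
        simp [Module.End.mul_apply, xOp_single, add_left_comm]
      | dd i j =>
        refine Finsupp.lhom_ext' fun m => LinearMap.ext_ring ?_
        simp [Module.End.mul_apply, dOp_comm i j]
      | dx i j =>
        refine Finsupp.lhom_ext' fun m => LinearMap.ext_ring ?_
        by_cases hij : i = j <;> simp [Module.End.mul_apply, dOp_xOp, hij]⟩

theorem rep_x (i : Fin n) : rep (x i : WeylAlgebra K n) = xOp i := by
  refine (RingQuot.liftAlgHom_mkAlgHom_apply K _ _ _).trans ?_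
  simp

theorem rep_d (i : Fin n) : rep (d i : WeylAlgebra K n) = dOp i := by
  refine (RingQuot.liftAlgHom_mkAlgHom_apply K _ _ _).trans ?_
  simp

/-- The coefficients `c_{αβ}` of an element `∑ c_{αβ} x^α ∂^β`. -/
noncomputable def coeffs : WeylAlgebra K n →ₗ[K] (WMon n →₀ K) :=
  (LinearMap.applyₗ (single 0 1)).comp rep.toLinearMap

theorem coeffs_mul (p q : WeylAlgebra K n) : coeffs (p * q) = rep p (coeffs q) := by
  simp [coeffs, Module.End.mul_apply]

theorem coeffs_monomial (m : WMon n) :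
    coeffs (monomial m : WeylAlgebra K n) = single m 1 := by
  have h1 : powProd (fun i => rep (d i : WeylAlgebra K n)) (fun i => m (Sum.inr i))
      (single 0 1) = single (∑ i, m (Sum.inr i) • (eD i : WMon n)) 1 := by
    refine (powProd_apply_single _ eD (fun m => ∀ i, m (Sum.inl i) = 0) ?_ ?_ _ 0 ?_).trans ?_
    · intro i m hm j
      simp [hm j]
    · intro i m hm
      simp [rep_d, dOp_single, hm i]
    · simp
    · simp
  have h2 := powProd_apply_single (fun i => rep (x i : WeylAlgebra K n)) eX (fun _ => True)
    (fun _ _ _ => trivial) (fun i m _ => by rw [rep_x, xOp_single]) (fun i => m (Sum.inl i))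
    (∑ i, m (Sum.inr i) • (eD i : WMon n)) trivial
  simp only [coeffs, monomial, LinearMap.comp_apply, AlgHom.toLinearMap_apply, map_mul,
    map_powProd, LinearMap.applyₗ_apply_apply, Module.End.mul_apply]
  rw [h1, h2, wmon_eq_sum]

theorem monomial_zero : (monomial 0 : WeylAlgebra K n) = 1 := by
  simp [monomial, powProd_zero]

theorem x_mul_monomial (i : Fin n) (m : WMon n) :
    (x i * monomial m : WeylAlgebra K n) = monomial (eX i + m) := by
  have h := mul_powProd (x : Fin n → WeylAlgebra K n) x_comm i (fun j => m (Sum.inl j))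
    (fun j => (eX i + m) (Sum.inl j)) (by simp [add_comm])
    (by intro j hj; simp [Ne.symm hj])
  simp only [monomial, h, mul_assoc]
  simp

theorem d_mul_monomial (i : Fin n) (m : WMon n) :
    (d i * monomial m : WeylAlgebra K n) =
      monomial (eD i + m) + (m (Sum.inl i) : K) • monomial (m - eX i) := by
  have h1 := mul_powProd (d : Fin n → WeylAlgebra K n) d_comm i (fun j => m (Sum.inr j))
    (fun j => (eD i + m) (Sum.inr j)) (by simp [add_comm])
    (by intro j hj; simp [Ne.symm hj])
  have h2 := deriv_mul_powProd (x : Fin n → WeylAlgebra K n) i (d i) 1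
    (by rw [d_mul_x, if_pos rfl])
    (by intro j hj; have := d_mul_x (K := K) j i; rw [if_neg hj, add_zero] at this; exact this)
    (fun j => Commute.one_left _) (fun j => m (Sum.inl j))
    (fun j => (m - eX i) (Sum.inl j)) (by simp)
    (by intro j hj; simp [Ne.symm hj])
  have h3 : (fun j => (eD i + m) (Sum.inl j)) = fun j => m (Sum.inl j) := by
    ext j; simp
  have h4 : (fun j => (m - eX i) (Sum.inr j)) = fun j => m (Sum.inr j) := by
    ext j; simp
  rw [monomial, ← mul_assoc, h2, one_mul, add_mul, mul_assoc, ← h1, monomial, monomial, h3, h4,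
    Nat.cast_smul_eq_nsmul, nsmul_eq_mul, mul_assoc]

theorem ofCoeffs_single (m : WMon n) :
    ofCoeffs (single m (1 : K)) = monomial m := by
  simp [ofCoeffs]

theorem x_mul_ofCoeffs (i : Fin n) (c : WMon n →₀ K) :
    x i * ofCoeffs c = ofCoeffs (xOp i c) := by
  suffices h : (LinearMap.mulLeft K (x i)).comp ofCoeffs = ofCoeffs.comp (xOp (K := K) i) from
    LinearMap.congr_fun h c
  refine Finsupp.lhom_ext' fun m => LinearMap.ext_ring ?_
  simp [ofCoeffs_single, xOp_single, x_mul_monomial]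

theorem d_mul_ofCoeffs (i : Fin n) (c : WMon n →₀ K) :
    d i * ofCoeffs c = ofCoeffs (dOp i c) := by
  suffices h : (LinearMap.mulLeft K (d i)).comp ofCoeffs = ofCoeffs.comp (dOp (K := K) i) from
    LinearMap.congr_fun h c
  refine Finsupp.lhom_ext' fun m => LinearMap.ext_ring ?_
  simp [ofCoeffs, dOp_single, d_mul_monomial]

theorem induction {C : WeylAlgebra K n → Prop} (hK : ∀ r : K, C (algebraMap K _ r))
    (hx : ∀ i, C (x i)) (hd : ∀ i, C (d i)) (hmul : ∀ p q, C p → C q → C (p * q))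
    (hadd : ∀ p q, C p → C q → C (p + q)) (p : WeylAlgebra K n) : C p := by
  obtain ⟨p, rfl⟩ := RingQuot.mkAlgHom_surjective K (WeylRel K n) p
  induction p using FreeAlgebra.induction with
  | grade0 r => exact (congrArg C (AlgHom.commutes _ r)).mpr (hK r)
  | grade1 k =>
    rcases k with i | i
    · exact hx i
    · exact hd i
  | mul p q hp hq => exact (congrArg C (map_mul _ p q)).mpr (hmul _ _ hp hq)
  | add p q hp hq => exact (congrArg C (map_add _ p q)).mpr (hadd _ _ hp hq)

theorem mul_ofCoeffs (p : WeylAlgebra K n) (c : WMon n →₀ K) :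
    p * ofCoeffs c = ofCoeffs (rep p c) := by
  induction p using WeylAlgebra.induction generalizing c with
  | hK r => simp [Algebra.algebraMap_eq_smul_one]
  | hx i => rw [rep_x, x_mul_ofCoeffs]
  | hd i => rw [rep_d, d_mul_ofCoeffs]
  | hmul p q hp hq => rw [mul_assoc, hq, hp, map_mul, Module.End.mul_apply]
  | hadd p q hp hq => rw [add_mul, hp, hq, map_add, LinearMap.add_apply, map_add]

theorem ofCoeffs_coeffs (p : WeylAlgebra K n) : ofCoeffs (coeffs p) = p := by
  have := mul_ofCoeffs p (single 0 1)
  rw [ofCoeffs_single, monomial_zero, mul_one] at this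
  exact this.symm

theorem coeffs_ofCoeffs (c : WMon n →₀ K) : coeffs (ofCoeffs c : WeylAlgebra K n) = c := by
  suffices h : (coeffs (K := K) (n := n)).comp ofCoeffs = LinearMap.id from
    LinearMap.congr_fun h c
  refine Finsupp.lhom_ext' fun m => LinearMap.ext_ring ?_
  simp [ofCoeffs_single, coeffs_monomial]

end WeylAlgebra

/-! ## Normally ordered monomials form a basis of the weighted homogenized Weyl algebra -/

namespace HWeylAlgebra

variable {K : Type*} [Field K] {n : ℕ} {u v : Fin n → ℕ}

/-- The generator `x_i`. -/
noncomputable def x (i : Fin n) : HWeylAlgebra K u v :=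
  RingQuot.mkAlgHom K (HWeylRel K u v) (FreeAlgebra.ι K (some (Sum.inl i)))

/-- The generator `∂_i`. -/
noncomputable def d (i : Fin n) : HWeylAlgebra K u v :=
  RingQuot.mkAlgHom K (HWeylRel K u v) (FreeAlgebra.ι K (some (Sum.inr i)))

/-- The generator `h`. -/
noncomputable def h : HWeylAlgebra K u v :=
  RingQuot.mkAlgHom K (HWeylRel K u v) (FreeAlgebra.ι K none)

theorem x_comm (i j : Fin n) : Commute (x i : HWeylAlgebra K u v) (x j) := by
  have := RingQuot.mkAlgHom_rel K (HWeylRel.xx (K := K) (u := u) (v := v) j i)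
  simp only [map_mul] at this
  exact this

theorem d_comm (i j : Fin n) : Commute (d i : HWeylAlgebra K u v) (d j) := by
  have := RingQuot.mkAlgHom_rel K (HWeylRel.dd (K := K) (u := u) (v := v) j i)
  simp only [map_mul] at this
  exact this

theorem x_h_comm (i : Fin n) : Commute (x i : HWeylAlgebra K u v) h := by
  have := RingQuot.mkAlgHom_rel K (HWeylRel.xh (K := K) (u := u) (v := v) i)
  simp only [map_mul] at this
  exact this

theorem d_h_comm (i : Fin n) : Commute (d i : HWeylAlgebra K u v) h := by
  have := RingQuot.mkAlgHom_rel K (HWeylRel.dh (K := K) (u := u) (v := v) i)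
  simp only [map_mul] at this
  exact this

theorem d_mul_x (i j : Fin n) :
    (d j * x i : HWeylAlgebra K u v) = x i * d j + if i = j then h ^ (u i + v j) else 0 := by
  have := RingQuot.mkAlgHom_rel K (HWeylRel.dx (K := K) (u := u) (v := v) i j)
  simp only [map_mul, map_add, apply_ite (RingQuot.mkAlgHom K (HWeylRel K u v)), map_pow,
    map_zero] at this
  exact this

/-- The normally ordered monomial `x^α ∂^β h^k`. -/
noncomputable def monomial (m : HMon n) : HWeylAlgebra K u v :=
  powProd x (fun i => m.1 (Sum.inl i)) * powProd d (fun i => m.1 (Sum.inr i)) * h ^ m.2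

/-- The element `∑ c_{αβk} x^α ∂^β h^k` with given coefficients. -/
noncomputable def ofCoeffs : (HMon n →₀ K) →ₗ[K] HWeylAlgebra K u v :=
  Finsupp.linearCombination K monomial

/-- Left multiplication by `x_i`, on coefficients. -/
noncomputable def xOp (i : Fin n) : Module.End K (HMon n →₀ K) :=
  Finsupp.linearCombination K fun m => single ((eX i, 0) + m) 1

/-- Left multiplication by `h`, on coefficients. -/
noncomputable def hOp : Module.End K (HMon n →₀ K) :=
  Finsupp.linearCombination K fun m => single ((0, 1) + m) 1

variable (u v) in
/-- Left multiplication by `∂_i`, on coefficients. -/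
noncomputable def dOp (i : Fin n) : Module.End K (HMon n →₀ K) :=
  Finsupp.linearCombination K fun m =>
    single ((eD i, 0) + m) 1 +
      (m.1 (Sum.inl i) : K) • single (m.1 - eX i, (u i + v i) + m.2) 1

theorem xOp_single (i : Fin n) (m : HMon n) :
    xOp i (single m (1 : K)) = single ((eX i, 0) + m) 1 := by
  simp [xOp]

theorem hOp_single (m : HMon n) : hOp (single m (1 : K)) = single ((0, 1) + m) 1 := by
  simp [hOp]

theorem hOp_pow_single (k : ℕ) (m : HMon n) :
    (hOp ^ k) (single m (1 : K)) = single ((0, k) + m) 1 := by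
  induction k with
  | zero => simp [← Prod.zero_eq_mk]
  | succ k ih =>
    rw [pow_succ', Module.End.mul_apply, ih, hOp_single, ← add_assoc]
    simp [add_comm]

theorem dOp_single (i : Fin n) (m : HMon n) :
    dOp u v i (single m (1 : K)) = single ((eD i, 0) + m) 1 +
      (m.1 (Sum.inl i) : K) • single (m.1 - eX i, (u i + v i) + m.2) 1 := by
  simp [dOp]

theorem dOp_comm (i j : Fin n) (m : HMon n) :
    dOp u v j (dOp u v i (single m (1 : K))) = dOp u v i (dOp u v j (single m (1 : K))) := by
  obtain ⟨m, k⟩ := m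
  simp only [dOp_single, map_add, map_smul, smul_add, smul_smul, wmon_eD_add_sub,
    wmon_sub_sub m i j, wmon_cast_mul_cast m i j, Prod.mk_add_mk, zero_add,
    add_left_comm (eD i) (eD j) m, add_left_comm (u i + v i) (u j + v j) k]
  simp only [Finsupp.add_apply, Finsupp.single_apply, reduceCtorEq, if_false, zero_add]
  abel

theorem dOp_xOp (i j : Fin n) (m : HMon n) :
    dOp u v j (xOp i (single m (1 : K))) = xOp i (dOp u v j (single m (1 : K))) +
      if i = j then (hOp ^ (u i + v j)) (single m 1) else 0 := by
  obtain ⟨m, k⟩ := m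
  simp only [dOp_single, xOp_single, map_add, map_smul, Prod.mk_add_mk, zero_add,
    add_left_comm (eD j) (eX i) m, hOp_pow_single]
  refine Eq.trans (congrArg₂ (· + ·) rfl ?_) (add_assoc _ _ _).symm
  by_cases hij : i = j
  · subst hij
    rw [if_pos rfl, wmon_add_sub_self]
    by_cases h0 : m (Sum.inl i) = 0
    · simp [h0]
    · rw [wmon_add_sub_cancel m i h0]
      simp [add_smul, add_comm]
  · simp [wmon_add_sub_of_ne m i j hij, hij]

/-- The representation of the weighted homogenized Weyl algebra on coefficient families. -/
noncomputable def rep : HWeylAlgebra K u v →ₐ[K] Module.End K (HMon n →₀ K) :=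
  RingQuot.liftAlgHom K (s := HWeylRel K u v)
    ⟨FreeAlgebra.lift K (fun g => g.elim hOp (Sum.elim xOp (dOp u v))), by
      intro a b hab
      cases hab with
      | xx i j =>
        refine Finsupp.lhom_ext' fun m => LinearMap.ext_ring ?_
        simp [Module.End.mul_apply, xOp_single, add_left_comm]
      | dd i j =>
        refine Finsupp.lhom_ext' fun m => LinearMap.ext_ring ?_
        simp [Module.End.mul_apply, dOp_comm i j]
      | xh i =>
        refine Finsupp.lhom_ext' fun m => LinearMap.ext_ring ?_
        simp [Module.End.mul_apply, xOp_single, hOp_single, add_left_comm]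
      | dh i =>
        refine Finsupp.lhom_ext' fun m => LinearMap.ext_ring ?_
        simp [Module.End.mul_apply, dOp_single, hOp, add_left_comm]
      | dx i j =>
        refine Finsupp.lhom_ext' fun m => LinearMap.ext_ring ?_
        by_cases hij : i = j <;> simp [Module.End.mul_apply, dOp_xOp, hij]⟩

theorem rep_x (i : Fin n) : rep (x i : HWeylAlgebra K u v) = xOp i := by
  refine (RingQuot.liftAlgHom_mkAlgHom_apply K _ _ _).trans ?_
  simp

theorem rep_d (i : Fin n) : rep (d i : HWeylAlgebra K u v) = dOp u v i := by
  refine (RingQuot.liftAlgHom_mkAlgHom_apply K _ _ _).trans ?_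
  simp

theorem rep_h : rep (h : HWeylAlgebra K u v) = hOp := by
  refine (RingQuot.liftAlgHom_mkAlgHom_apply K _ _ _).trans ?_
  simp

/-- The coefficients `c_{αβk}` of an element `∑ c_{αβk} x^α ∂^β h^k`. -/
noncomputable def coeffs : HWeylAlgebra K u v →ₗ[K] (HMon n →₀ K) :=
  (LinearMap.applyₗ (single 0 1)).comp rep.toLinearMap

theorem coeffs_mul (p q : HWeylAlgebra K u v) : coeffs (p * q) = rep p (coeffs q) := by
  simp [coeffs, Module.End.mul_apply]

theorem sum_smul_mk_zero (a : Fin n → ℕ) (e : Fin n → WMon n) :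
    (∑ i, a i • ((e i, 0) : HMon n)) = (∑ i, a i • e i, 0) := by
  ext <;> simp [Prod.fst_sum, Prod.snd_sum]

theorem coeffs_monomial (m : HMon n) :
    coeffs (monomial m : HWeylAlgebra K u v) = single m 1 := by
  obtain ⟨m, k⟩ := m
  have h1 : powProd (fun i => rep (d i : HWeylAlgebra K u v)) (fun i => m (Sum.inr i))
      (single (0, k) 1) = single (∑ i, m (Sum.inr i) • (eD i : WMon n), k) 1 := by
    refine (powProd_apply_single _ (fun i => (eD i, 0))
      (fun m => ∀ i, m.1 (Sum.inl i) = 0) ?_ ?_ _ (0, k) ?_).trans ?_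
    · intro i m hm j
      simp [hm j]
    · intro i m hm
      simp [rep_d, dOp_single, hm i]
    · simp
    · rw [sum_smul_mk_zero]
      simp
  have h2 := powProd_apply_single (fun i => rep (x i : HWeylAlgebra K u v))
    (fun i => (eX i, 0)) (fun _ => True)
    (fun _ _ _ => trivial) (fun i m _ => by rw [rep_x, xOp_single]) (fun i => m (Sum.inl i))
    (∑ i, m (Sum.inr i) • (eD i : WMon n), k) trivial
  have h3 : (rep (h : HWeylAlgebra K u v) ^ k) (single 0 1) = single (0, k) 1 := by
    rw [rep_h, hOp_pow_single, add_zero]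
  simp only [coeffs, monomial, LinearMap.comp_apply, AlgHom.toLinearMap_apply, map_mul,
    map_powProd, map_pow, LinearMap.applyₗ_apply_apply, Module.End.mul_apply]
  rw [h3, h1, h2, sum_smul_mk_zero, Prod.mk_add_mk, wmon_eq_sum, zero_add]

theorem monomial_zero : (monomial 0 : HWeylAlgebra K u v) = 1 := by
  simp [monomial, powProd_zero]

theorem x_mul_monomial (i : Fin n) (m : HMon n) :
    (x i * monomial m : HWeylAlgebra K u v) = monomial ((eX i, 0) + m) := by
  have h := mul_powProd (x : Fin n → HWeylAlgebra K u v) x_comm i (fun j => m.1 (Sum.inl j))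
    (fun j => (eX i + m.1) (Sum.inl j)) (by simp [add_comm])
    (by intro j hj; simp [Ne.symm hj])
  simp only [monomial, Prod.fst_add, h, mul_assoc]
  simp

theorem commute_powProd {A : Type*} [Monoid A] (y : A) (z : Fin n → A) (a : Fin n → ℕ)
    (hz : ∀ i, Commute (z i) y) : Commute y (powProd z a) := by
  refine Commute.list_prod_right _ _ fun b hb => ?_
  obtain ⟨i, -, rfl⟩ := List.mem_map.1 hb
  exact ((hz i).pow_left (a i)).symm

theorem h_mul_monomial (m : HMon n) :
    (h * monomial m : HWeylAlgebra K u v) = monomial ((0, 1) + m) := by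
  simp only [monomial, Prod.fst_add, Prod.snd_add, zero_add]
  rw [add_comm 1 m.2, pow_succ', ← mul_assoc h,
    ((commute_powProd h x _ x_h_comm).mul_right (commute_powProd h d _ d_h_comm)).eq, mul_assoc _ h]

theorem d_mul_monomial (i : Fin n) (m : HMon n) :
    (d i * monomial m : HWeylAlgebra K u v) = monomial ((eD i, 0) + m) +
      (m.1 (Sum.inl i) : K) • monomial (m.1 - eX i, (u i + v i) + m.2) := by
  obtain ⟨m, k⟩ := m
  have h1 := mul_powProd (d : Fin n → HWeylAlgebra K u v) d_comm i (fun j => m (Sum.inr j))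
    (fun j => (eD i + m) (Sum.inr j)) (by simp [add_comm])
    (by intro j hj; simp [Ne.symm hj])
  have h2 := deriv_mul_powProd (x : Fin n → HWeylAlgebra K u v) i (d i) (h ^ (u i + v i))
    (by rw [d_mul_x, if_pos rfl])
    (by
      intro j hj
      have := d_mul_x (K := K) (u := u) (v := v) j i
      rw [if_neg hj, add_zero] at this
      exact this)
    (fun j => ((x_h_comm j).pow_right _).symm) (fun j => m (Sum.inl j))
    (fun j => (m - eX i) (Sum.inl j)) (by simp)
    (by intro j hj; simp [Ne.symm hj])
  have h3 : (fun j => (eD i + m) (Sum.inl j)) = fun j => m (Sum.inl j) := by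
    ext j; simp
  have h4 : (fun j => (m - eX i) (Sum.inr j)) = fun j => m (Sum.inr j) := by
    ext j; simp
  have h5 : ∀ X D : HWeylAlgebra K u v, Commute h X → Commute h D →
      h ^ (u i + v i) * X * (D * h ^ k) = X * D * h ^ ((u i + v i) + k) := by
    intro X D hX hD
    rw [(hX.pow_left _).eq, mul_assoc, ← mul_assoc (h ^ (u i + v i)), (hD.pow_left _).eq,
      mul_assoc, ← pow_add, mul_assoc]
  simp only [monomial, Prod.mk_add_mk, zero_add]
  rw [mul_assoc (powProd x _), ← mul_assoc (d i), h2, add_mul, mul_assoc (powProd x _) (d i),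
    ← mul_assoc (d i), ← h1, h3, h4, Nat.cast_smul_eq_nsmul, nsmul_eq_mul,
    mul_assoc (powProd x _) (powProd d _), mul_assoc (m (Sum.inl i) : HWeylAlgebra K u v),
    h5 _ _ (commute_powProd h x _ x_h_comm) (commute_powProd h d _ d_h_comm)]

theorem ofCoeffs_single (m : HMon n) :
    ofCoeffs (single m (1 : K)) = (monomial m : HWeylAlgebra K u v) := by
  simp [ofCoeffs]

theorem x_mul_ofCoeffs (i : Fin n) (c : HMon n →₀ K) :
    (x i * ofCoeffs c : HWeylAlgebra K u v) = ofCoeffs (xOp i c) := by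
  suffices h : (LinearMap.mulLeft K (x i : HWeylAlgebra K u v)).comp ofCoeffs =
      ofCoeffs.comp (xOp (K := K) i) from LinearMap.congr_fun h c
  refine Finsupp.lhom_ext' fun m => LinearMap.ext_ring ?_
  simp [ofCoeffs, xOp_single, x_mul_monomial]

theorem h_mul_ofCoeffs (c : HMon n →₀ K) :
    (h * ofCoeffs c : HWeylAlgebra K u v) = ofCoeffs (hOp c) := by
  suffices h : (LinearMap.mulLeft K (h : HWeylAlgebra K u v)).comp ofCoeffs =
      ofCoeffs.comp (hOp (K := K)) from LinearMap.congr_fun h c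
  refine Finsupp.lhom_ext' fun m => LinearMap.ext_ring ?_
  simp [ofCoeffs, hOp_single, h_mul_monomial]

theorem d_mul_ofCoeffs (i : Fin n) (c : HMon n →₀ K) :
    (d i * ofCoeffs c : HWeylAlgebra K u v) = ofCoeffs (dOp u v i c) := by
  suffices h : (LinearMap.mulLeft K (d i : HWeylAlgebra K u v)).comp ofCoeffs =
      ofCoeffs.comp (dOp (K := K) u v i) from LinearMap.congr_fun h c
  refine Finsupp.lhom_ext' fun m => LinearMap.ext_ring ?_
  simp [ofCoeffs, dOp_single, d_mul_monomial]

theorem induction {C : HWeylAlgebra K u v → Prop} (hK : ∀ r : K, C (algebraMap K _ r))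
    (hh : C h) (hx : ∀ i, C (x i)) (hd : ∀ i, C (d i))
    (hmul : ∀ p q, C p → C q → C (p * q))
    (hadd : ∀ p q, C p → C q → C (p + q)) (p : HWeylAlgebra K u v) : C p := by
  obtain ⟨p, rfl⟩ := RingQuot.mkAlgHom_surjective K (HWeylRel K u v) p
  induction p using FreeAlgebra.induction with
  | grade0 r => exact (congrArg C (AlgHom.commutes _ r)).mpr (hK r)
  | grade1 k =>
    rcases k with _ | i | i
    · exact hh
    · exact hx i
    · exact hd i
  | mul p q hp hq => exact (congrArg C (map_mul _ p q)).mpr (hmul _ _ hp hq)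
  | add p q hp hq => exact (congrArg C (map_add _ p q)).mpr (hadd _ _ hp hq)

theorem mul_ofCoeffs (p : HWeylAlgebra K u v) (c : HMon n →₀ K) :
    p * ofCoeffs c = ofCoeffs (rep p c) := by
  induction p using HWeylAlgebra.induction generalizing c with
  | hK r => simp [Algebra.algebraMap_eq_smul_one]
  | hh => rw [rep_h, h_mul_ofCoeffs]
  | hx i => rw [rep_x, x_mul_ofCoeffs]
  | hd i => rw [rep_d, d_mul_ofCoeffs]
  | hmul p q hp hq => rw [mul_assoc, hq, hp, map_mul, Module.End.mul_apply]
  | hadd p q hp hq => rw [add_mul, hp, hq, map_add, LinearMap.add_apply, map_add]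

theorem ofCoeffs_coeffs (p : HWeylAlgebra K u v) : ofCoeffs (coeffs p) = p := by
  have := mul_ofCoeffs p (single 0 1)
  rw [ofCoeffs_single, monomial_zero, mul_one] at this
  exact this.symm

theorem coeffs_ofCoeffs (c : HMon n →₀ K) :
    coeffs (ofCoeffs c : HWeylAlgebra K u v) = c := by
  suffices h : (coeffs (K := K) (u := u) (v := v)).comp ofCoeffs = LinearMap.id from
    LinearMap.congr_fun h c
  refine Finsupp.lhom_ext' fun m => LinearMap.ext_ring ?_
  simp [ofCoeffs_single, coeffs_monomial]

end HWeylAlgebra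

/-! ## Weighted homogenization -/

/-- The weighted degree `uα + vβ` of the monomial `x^α ∂^β`. -/
def wDeg {n : ℕ} (u v : Fin n → ℕ) (m : WMon n) : ℕ :=
  ∑ i, (u i * m (Sum.inl i) + v i * m (Sum.inr i))

/-- The weighted degree `uα + vβ + k` of the monomial `x^α ∂^β h^k`. -/
def hDeg {n : ℕ} (u v : Fin n → ℕ) (m : HMon n) : ℕ := wDeg u v m.1 + m.2

/-- The weighted homogenization `∑ c_{αβ} h^{deg(p) - (uα + vβ)} x^α ∂^β` of
`p = ∑ c_{αβ} x^α ∂^β`, where `deg(p)` is the largest weighted degree of a monomial of `p`. -/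
noncomputable def homogenization {K : Type*} [Field K] {n : ℕ} (u v : Fin n → ℕ)
    (p : WeylAlgebra K n) : HWeylAlgebra K u v :=
  (WeylAlgebra.coeffs p).sum fun m c =>
    c • HWeylAlgebra.monomial
      (m, (WeylAlgebra.coeffs p).support.sup (wDeg u v) - wDeg u v m)

/-- The left ideal generated by the weighted homogenizations of the elements of `I`. -/
noncomputable def homogenizedIdeal {K : Type*} [Field K] {n : ℕ} (u v : Fin n → ℕ)
    (I : Ideal (WeylAlgebra K n)) : Ideal (HWeylAlgebra K u v) :=
  Ideal.span (homogenization u v '' (I : Set (WeylAlgebra K n)))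

/-- All monomials `x^α ∂^β h^k` of `f` have the same weighted degree `uα + vβ + k`. -/
def IsWeightedHomogeneous {K : Type*} [Field K] {n : ℕ} {u v : Fin n → ℕ}
    (f : HWeylAlgebra K u v) : Prop :=
  ∃ r : ℕ, ∀ m ∈ (HWeylAlgebra.coeffs f).support, hDeg u v m = r

/-! ## Initial forms and initial ideals with respect to the weight `(-w, w, 0)` -/

/-- The weight `-wα + wβ` of the monomial `x^α ∂^β`. -/
noncomputable def vWeight {n : ℕ} (w : Fin n → ℝ) (m : WMon n) : ℝ :=
  ∑ i, (-(w i) * m (Sum.inl i) + w i * m (Sum.inr i))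

open Classical in
/-- The `(-w, w, 0)`-initial form of `f`: the sum of those terms `c x^α ∂^β h^k` of `f` whose
weight `-wα + wβ` is maximal among the terms of `f` (in particular it is `0` for `f = 0`). -/
noncomputable def initialForm {K : Type*} [Field K] {n : ℕ} {u v : Fin n → ℕ} (w : Fin n → ℝ)
    (f : HWeylAlgebra K u v) : HWeylAlgebra K u v :=
  HWeylAlgebra.ofCoeffs ((HWeylAlgebra.coeffs f).filter fun m =>
    ∀ m' ∈ (HWeylAlgebra.coeffs f).support, vWeight w m'.1 ≤ vWeight w m.1)

section InitialIdeal

variable {K : Type*} [Field K] {n : ℕ} {u v : Fin n → ℕ}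

theorem vWeight_add (w : Fin n → ℝ) (a b : WMon n) :
    vWeight w (a + b) = vWeight w a + vWeight w b := by
  simp only [vWeight, Finsupp.add_apply, Nat.cast_add, ← Finset.sum_add_distrib]
  exact Finset.sum_congr rfl fun i _ => by ring

theorem vWeight_eX (w : Fin n → ℝ) (i : Fin n) : vWeight w (eX i) = -(w i) := by
  simp [vWeight, Finsupp.single_apply]

theorem vWeight_eD (w : Fin n → ℝ) (i : Fin n) : vWeight w (eD i) = w i := by
  simp [vWeight, Finsupp.single_apply]

open Classical in
theorem filter_shift (w : Fin n → ℝ) (T : Module.End K (HMon n →₀ K)) (s : ℝ)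
    (hT : ∀ m m', m' ∈ (T (single m 1)).support → vWeight w m'.1 = vWeight w m.1 + s)
    (c : HMon n →₀ K) (r : ℝ) :
    T (c.filter fun m => vWeight w m.1 = r) =
      (T c).filter fun m => vWeight w m.1 = r + s := by
  induction c using Finsupp.induction_linear with
  | zero => rw [Finsupp.filter_zero, map_zero, Finsupp.filter_zero]
  | add c c' hc hc' => rw [Finsupp.filter_add, map_add, map_add, Finsupp.filter_add, hc, hc']
  | single m a =>
    have e : single m a = a • single m (1 : K) := by simp
    rw [e, Finsupp.filter_smul, map_smul, map_smul, Finsupp.filter_smul]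
    congr 1
    by_cases hm : vWeight w m.1 = r
    · rw [Finsupp.filter_single_of_pos (fun m : HMon n => vWeight w m.1 = r) hm, Eq.comm, Finsupp.filter_eq_self_iff]
      intro m' hm'
      rw [hT m m' (Finsupp.mem_support_iff.2 hm'), hm]
    · rw [Finsupp.filter_single_of_neg (fun m : HMon n => vWeight w m.1 = r) hm, map_zero, Eq.comm, Finsupp.filter_eq_zero_iff]
      intro m' hm'
      by_contra h0
      have := hT m m' (Finsupp.mem_support_iff.2 h0)
      exact hm (by linarith)

open Classical in
theorem initialForm_eq_filter (w : Fin n → ℝ) (f : HWeylAlgebra K u v) (r : ℝ)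
    (hr : ∀ m ∈ (HWeylAlgebra.coeffs f).support, vWeight w m.1 ≤ r)
    (hne : ∃ m ∈ (HWeylAlgebra.coeffs f).support, vWeight w m.1 = r) :
    initialForm w f =
      HWeylAlgebra.ofCoeffs ((HWeylAlgebra.coeffs f).filter fun m => vWeight w m.1 = r) := by
  obtain ⟨m₀, hm₀, rfl⟩ := hne
  unfold initialForm
  congr 1
  ext m
  by_cases hm : m ∈ (HWeylAlgebra.coeffs f).support
  · simp only [Finsupp.filter_apply]
    refine if_congr ⟨fun h => le_antisymm (hr m hm) (h m₀ hm₀), fun h m' hm' => ?_⟩ rfl rfl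
    rw [h]
    exact hr m' hm'
  · simp only [Finsupp.filter_apply, Finsupp.notMem_support_iff.1 hm, ite_self]

theorem initialForm_zero (w : Fin n → ℝ) : initialForm w (0 : HWeylAlgebra K u v) = 0 := by
  rw [initialForm, map_zero, Finsupp.filter_zero, map_zero]

theorem mul_initialForm_mem (w : Fin n → ℝ) (J : Ideal (HWeylAlgebra K u v))
    (g : HWeylAlgebra K u v) (s : ℝ)
    (hT : ∀ m m', m' ∈ (HWeylAlgebra.rep g (single m 1)).support →
      vWeight w m'.1 = vWeight w m.1 + s)
    (f : HWeylAlgebra K u v) (hf : f ∈ J) :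
    g * initialForm w f ∈
      Submodule.span K (initialForm w '' (J : Set (HWeylAlgebra K u v))) := by
  classical
  by_cases hc : (HWeylAlgebra.coeffs f).support = ∅
  · have : initialForm w f = 0 := by
      rw [initialForm, Finsupp.support_eq_empty.1 hc, Finsupp.filter_zero, map_zero]
    rw [this, mul_zero]
    exact Submodule.zero_mem _
  · obtain ⟨m₀, hm₀, hmax⟩ := Finset.exists_max_image (HWeylAlgebra.coeffs f).support
      (fun m => vWeight w m.1) (Finset.nonempty_iff_ne_empty.2 hc)
    rw [initialForm_eq_filter w f (vWeight w m₀.1) hmax ⟨m₀, hm₀, rfl⟩,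
      HWeylAlgebra.mul_ofCoeffs, filter_shift w _ s hT, ← HWeylAlgebra.coeffs_mul]
    by_cases hne : ∃ m ∈ (HWeylAlgebra.coeffs (g * f)).support,
        vWeight w m.1 = vWeight w m₀.1 + s
    · rw [← initialForm_eq_filter w (g * f) _ ?_ hne]
      · exact Submodule.subset_span ⟨g * f, J.mul_mem_left g hf, rfl⟩
      · intro m hm
        by_contra hlt
        rw [not_le] at hlt
        have h1 := filter_shift w _ s hT (HWeylAlgebra.coeffs f) (vWeight w m.1 - s)
        rw [(Finsupp.filter_eq_zero_iff _ _).2, map_zero, ← HWeylAlgebra.coeffs_mul,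
          sub_add_cancel, Eq.comm, Finsupp.filter_eq_zero_iff] at h1
        · exact Finsupp.mem_support_iff.1 hm (h1 m rfl)
        · intro m' hm'
          by_contra h0
          have := hmax m' (Finsupp.mem_support_iff.2 h0)
          linarith
    · have h0 : ((HWeylAlgebra.coeffs (g * f)).filter
          fun m => vWeight w m.1 = vWeight w m₀.1 + s) = 0 := by
        rw [Finsupp.filter_eq_zero_iff]
        intro m hm
        by_contra h
        exact hne ⟨m, Finsupp.mem_support_iff.2 h, hm⟩
      rw [h0, map_zero]
      exact Submodule.zero_mem _

theorem mul_mem_span_initialForm (w : Fin n → ℝ) (J : Ideal (HWeylAlgebra K u v))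
    (g f : HWeylAlgebra K u v)
    (hf : f ∈ Submodule.span K (initialForm w '' (J : Set (HWeylAlgebra K u v)))) :
    g * f ∈ Submodule.span K (initialForm w '' (J : Set (HWeylAlgebra K u v))) := by
  have key : ∀ (g : HWeylAlgebra K u v) (s : ℝ),
      (∀ m m', m' ∈ (HWeylAlgebra.rep g (single m 1)).support →
        vWeight w m'.1 = vWeight w m.1 + s) →
      ∀ f ∈ Submodule.span K (initialForm w '' (J : Set (HWeylAlgebra K u v))),
        g * f ∈ Submodule.span K (initialForm w '' (J : Set (HWeylAlgebra K u v))) := by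
    intro g s hT f hf
    induction hf using Submodule.span_induction with
    | mem f hf =>
      obtain ⟨f, hf, rfl⟩ := hf
      exact mul_initialForm_mem w J g s hT f hf
    | zero => simp
    | add f f' _ _ h h' => rw [mul_add]; exact Submodule.add_mem _ h h'
    | smul a f _ h => rw [mul_smul_comm]; exact Submodule.smul_mem _ a h
  induction g using HWeylAlgebra.induction generalizing f with
  | hK r => rw [← Algebra.smul_def]; exact Submodule.smul_mem _ r hf
  | hh =>
    refine key _ 0 (fun m m' hm' => ?_) f hf
    rw [HWeylAlgebra.rep_h, HWeylAlgebra.hOp_single] at hm'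
    rw [Finset.mem_singleton.1 (Finsupp.support_single_subset hm')]
    simp
  | hx i =>
    refine key _ (-(w i)) (fun m m' hm' => ?_) f hf
    rw [HWeylAlgebra.rep_x, HWeylAlgebra.xOp_single] at hm'
    rw [Finset.mem_singleton.1 (Finsupp.support_single_subset hm'), Prod.fst_add, vWeight_add,
      vWeight_eX, add_comm]
  | hd i =>
    refine key _ (w i) (fun m m' hm' => ?_) f hf
    rw [HWeylAlgebra.rep_d, HWeylAlgebra.dOp_single] at hm'
    by_cases h0 : m.1 (Sum.inl i) = 0
    · rw [h0, Nat.cast_zero, zero_smul, add_zero] at hm'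
      rw [Finset.mem_singleton.1 (Finsupp.support_single_subset hm'), Prod.fst_add,
        vWeight_add, vWeight_eD, add_comm]
    · rcases Finset.mem_union.1 (Finsupp.support_add hm') with h1 | h1
      · rw [Finset.mem_singleton.1 (Finsupp.support_single_subset h1), Prod.fst_add,
          vWeight_add, vWeight_eD, add_comm]
      · have h2 := vWeight_add w (eX i) (m.1 - eX i)
        rw [wmon_add_sub_cancel m.1 i h0, vWeight_eX] at h2
        rw [Finset.mem_singleton.1
          (Finsupp.support_single_subset (Finsupp.support_smul h1)), h2]
        ring
  | hmul p q hp hq => rw [mul_assoc]; exact hp _ (hq _ hf)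
  | hadd p q hp hq => rw [add_mul]; exact Submodule.add_mem _ (hp _ hf) (hq _ hf)

/-- The initial ideal of a left ideal `J` with respect to the weight `(-w, w, 0)`: the `K`-linear
span of the initial forms of the elements of `J`, which is a left ideal. -/
noncomputable def initialIdeal (w : Fin n → ℝ) (J : Ideal (HWeylAlgebra K u v)) :
    Ideal (HWeylAlgebra K u v) where
  carrier := Submodule.span K (initialForm w '' (J : Set (HWeylAlgebra K u v)))
  add_mem' := fun ha hb => Submodule.add_mem _ ha hb
  zero_mem' := Submodule.zero_mem _
  smul_mem' := fun g _ hf => mul_mem_span_initialForm w J g _ hf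

end InitialIdeal

/-! ## Orderings on monomials and left Gröbner bases -/

/-- The refinement `≺_{(-w,w)}` of the weight `-wα + wβ` by the relation `lt`. -/
def WeightLT {n : ℕ} (w : Fin n → ℝ) (lt : WMon n → WMon n → Prop) (a b : WMon n) : Prop :=
  vWeight w a < vWeight w b ∨ vWeight w a = vWeight w b ∧ lt a b

/-- The homogenized ordering `≺^{(h)}` associated with `lt`: compare first the weighted degrees
`uα + vβ + k`, then the monomials obtained by putting `h = 1`. -/
def HomogenizedLT {n : ℕ} (u v : Fin n → ℕ) (lt : WMon n → WMon n → Prop) (a b : HMon n) :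
    Prop :=
  hDeg u v a < hDeg u v b ∨ hDeg u v a = hDeg u v b ∧ lt a.1 b.1

/-- `m` is the leading monomial of `f` with respect to the ordering `lt`. -/
def IsLeadingMonomial {K : Type*} [Field K] {n : ℕ} {u v : Fin n → ℕ}
    (lt : HMon n → HMon n → Prop) (f : HWeylAlgebra K u v) (m : HMon n) : Prop :=
  m ∈ (HWeylAlgebra.coeffs f).support ∧
    ∀ m' ∈ (HWeylAlgebra.coeffs f).support, m' ≠ m → lt m' m

/-- `G` is a left Gröbner basis of the left ideal `J` with respect to the ordering `lt`:
`G ⊆ J`, and the leading monomial of every non-zero element of `J` is divisible by the leading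
monomial of an element of `G`. -/
def IsLeftGroebnerBasis {K : Type*} [Field K] {n : ℕ} {u v : Fin n → ℕ}
    (lt : HMon n → HMon n → Prop) (J : Ideal (HWeylAlgebra K u v))
    (G : Set (HWeylAlgebra K u v)) : Prop :=
  G ⊆ (J : Set (HWeylAlgebra K u v)) ∧
    ∀ f ∈ J, f ≠ 0 → ∃ g ∈ G, ∃ a b : HMon n,
      IsLeadingMonomial lt g a ∧ IsLeadingMonomial lt f b ∧ a ≤ b

/-! ## Weighted homogeneous components -/

section WeightedHomogeneousComponents

variable {K : Type*} [Field K] {n : ℕ} {u v : Fin n → ℕ}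

/-! Write `J` for the homogenized ideal. It is generated by weighted homogeneous elements, and
multiplication by each generator of the algebra shifts the weighted degree by a constant, so `J`
contains every weighted homogeneous component of its elements
(`homogeneousPart_mem_homogenizedIdeal`).

The two orderings are linked inside a single weighted degree. There the ordering on the side of `J`
compares the weight `-wα + wβ` first and `≺` second. Hence a weighted homogeneous element and its
initial form have the same leading monomial, each for its own ordering
(`IsLeadingMonomial.initialForm`).

An element `f` of the initial ideal is only a linear combination of initial forms, possibly of
inhomogeneous elements, so it need not be an initial form itself. Let `m` be its leading monomial,
of weighted degree `r` and weight `s`. Because `J` is graded, the part of `f` of bidegree `(r, s)`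
is the part of weight `s` of some `p` in `J` that lives in degree `r` and in weights at most `s`
(`exists_mem_coeffs_eq_of_mem_initialIdeal`). Then `m` is the leading monomial of `p`, and the given
basis supplies a `g` whose leading monomial divides `m`. Passing to the initial form of `g` keeps
that leading monomial. -/

theorem filter_of_forall_iff (T : Module.End K (HMon n →₀ K)) (P Q : HMon n → Prop)
    [DecidablePred P] [DecidablePred Q]
    (hT : ∀ m m', m' ∈ (T (single m 1)).support → (Q m' ↔ P m)) (c : HMon n →₀ K) :
    T (c.filter P) = (T c).filter Q := by
  induction c using Finsupp.induction_linear with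
  | zero => rw [Finsupp.filter_zero, map_zero, Finsupp.filter_zero]
  | add c c' hc hc' => rw [Finsupp.filter_add, map_add, map_add, Finsupp.filter_add, hc, hc']
  | single m a =>
    have e : single m a = a • single m (1 : K) := by simp
    rw [e, Finsupp.filter_smul, map_smul, map_smul, Finsupp.filter_smul]
    congr 1
    by_cases hm : P m
    · rw [Finsupp.filter_single_of_pos P hm, Eq.comm, Finsupp.filter_eq_self_iff]
      exact fun m' hm' => (hT m m' (Finsupp.mem_support_iff.2 hm')).2 hm
    · rw [Finsupp.filter_single_of_neg P hm, map_zero, Eq.comm, Finsupp.filter_eq_zero_iff]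
      intro m' hm'
      by_contra h0
      exact hm ((hT m m' (Finsupp.mem_support_iff.2 h0)).1 hm')

/-! ### Weighted degrees and weighted homogeneous components. -/

theorem wDeg_add (a b : WMon n) : wDeg u v (a + b) = wDeg u v a + wDeg u v b := by
  simp only [wDeg, Finsupp.add_apply, ← Finset.sum_add_distrib]
  exact Finset.sum_congr rfl fun i _ => by ring

theorem wDeg_eX (i : Fin n) : wDeg u v (eX i) = u i := by
  simp [wDeg, Finsupp.single_apply]

theorem wDeg_eD (i : Fin n) : wDeg u v (eD i) = v i := by
  simp [wDeg, Finsupp.single_apply]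

theorem hDeg_add (a b : HMon n) : hDeg u v (a + b) = hDeg u v a + hDeg u v b := by
  simp only [hDeg, Prod.fst_add, Prod.snd_add, wDeg_add]
  ring

open Classical in
/-- The weighted homogeneous component of `f` of weighted degree `r`. -/
noncomputable def homogeneousPart (r : ℕ) : HWeylAlgebra K u v →ₗ[K] HWeylAlgebra K u v where
  toFun f := HWeylAlgebra.ofCoeffs ((HWeylAlgebra.coeffs f).filter fun m => hDeg u v m = r)
  map_add' f g := by rw [map_add, Finsupp.filter_add, map_add]
  map_smul' a f := by rw [map_smul, Finsupp.filter_smul, map_smul, RingHom.id_apply]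

open Classical in
theorem coeffs_homogeneousPart (r : ℕ) (f : HWeylAlgebra K u v) :
    HWeylAlgebra.coeffs (homogeneousPart r f) =
      (HWeylAlgebra.coeffs f).filter fun m => hDeg u v m = r :=
  HWeylAlgebra.coeffs_ofCoeffs _

/-! ### Weighted homogeneous components of products. -/

/-- Left multiplication by an element that raises degrees by exactly `s` commutes with taking
components up to the shift: the degree `r` part of `g * f` is `g` times the degree `r - s` part of
`f`. -/
theorem homogeneousPart_mul_mem {J : Ideal (HWeylAlgebra K u v)} {g f : HWeylAlgebra K u v}
    (s : ℕ) (hT : ∀ m m', m' ∈ (HWeylAlgebra.rep g (single m 1)).support →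
      hDeg u v m' = hDeg u v m + s)
    (hf : ∀ r, homogeneousPart r f ∈ J) (r : ℕ) : homogeneousPart r (g * f) ∈ J := by
  classical
  have key : homogeneousPart r (g * f) =
      g * HWeylAlgebra.ofCoeffs ((HWeylAlgebra.coeffs f).filter
        fun m => hDeg u v m + s = r) := by
    rw [HWeylAlgebra.mul_ofCoeffs,
      filter_of_forall_iff _ (fun m => hDeg u v m + s = r) (fun m => hDeg u v m = r)
      (fun m m' hm' => by rw [hT m m' hm']), ← HWeylAlgebra.coeffs_mul]
    rfl
  rw [key]
  refine J.mul_mem_left _ ?_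
  -- The condition `hDeg u v m + s = r` becomes a component of `f` only when `s ≤ r`. Otherwise no
  -- monomial satisfies it, whereas truncated subtraction would wrongly select degree `0`.
  by_cases hr : s ≤ r
  · have e : (fun m : HMon n => hDeg u v m + s = r) = fun m => hDeg u v m = r - s := by
      ext m; omega
    simp only [e]
    exact hf (r - s)
  · rw [(Finsupp.filter_eq_zero_iff _ _).2 fun m hm => by omega, map_zero]
    exact J.zero_mem

/-- The generators `h`, `x_i`, `∂_i` shift the degree by `1`, `u i`, `v i`, and the set of
multipliers `g` that preserve the property is closed under sums and products. For products it
matters that `f` varies: the property of `q * f` is fed into the claim for `p`. -/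
theorem homogeneousPart_mul_mem_of_forall {J : Ideal (HWeylAlgebra K u v)}
    (g : HWeylAlgebra K u v) {f : HWeylAlgebra K u v}
    (hf : ∀ r, homogeneousPart r f ∈ J) (r : ℕ) : homogeneousPart r (g * f) ∈ J := by
  induction g using HWeylAlgebra.induction generalizing f r with
  | hK a =>
    rw [← Algebra.smul_def, map_smul, Algebra.smul_def]
    exact J.mul_mem_left _ (hf r)
  | hh =>
    refine homogeneousPart_mul_mem 1 (fun m m' hm' => ?_) hf r
    rw [HWeylAlgebra.rep_h, HWeylAlgebra.hOp_single] at hm'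
    rw [Finset.mem_singleton.1 (Finsupp.support_single_subset hm'), hDeg_add, add_comm]
    simp [hDeg, wDeg]
  | hx i =>
    refine homogeneousPart_mul_mem (u i) (fun m m' hm' => ?_) hf r
    rw [HWeylAlgebra.rep_x, HWeylAlgebra.xOp_single] at hm'
    rw [Finset.mem_singleton.1 (Finsupp.support_single_subset hm'), hDeg_add, add_comm]
    simp [hDeg, wDeg_eX]
  | hd i =>
    refine homogeneousPart_mul_mem (v i) (fun m m' hm' => ?_) hf r
    rw [HWeylAlgebra.rep_d, HWeylAlgebra.dOp_single] at hm'
    have hD : hDeg u v ((eD i, 0) + m) = hDeg u v m + v i := by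
      rw [hDeg_add, add_comm]
      simp [hDeg, wDeg_eD]
    -- The commutator term loses one `x_i` and gains `h ^ (u i + v i)`, a net shift of `v i`, just
    -- like the leading term. When `x_i` does not occur the subtraction of exponents truncates, but
    -- then the coefficient of that term is zero.
    by_cases h0 : m.1 (Sum.inl i) = 0
    · rw [h0, Nat.cast_zero, zero_smul, add_zero] at hm'
      rw [Finset.mem_singleton.1 (Finsupp.support_single_subset hm'), hD]
    · rcases Finset.mem_union.1 (Finsupp.support_add hm') with h1 | h1
      · rw [Finset.mem_singleton.1 (Finsupp.support_single_subset h1), hD]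
      · have h2 := wDeg_add (u := u) (v := v) (eX i) (m.1 - eX i)
        rw [wmon_add_sub_cancel m.1 i h0, wDeg_eX] at h2
        rw [Finset.mem_singleton.1 (Finsupp.support_single_subset (Finsupp.support_smul h1))]
        simp only [hDeg]
        omega
  | hmul p q hp hq => rw [mul_assoc]; exact hp (hq hf) r
  | hadd p q hp hq => rw [add_mul, map_add]; exact J.add_mem (hp hf r) (hq hf r)

/-! ### The homogenized ideal is graded. -/

theorem isWeightedHomogeneous_homogenization (p : WeylAlgebra K n) :
    IsWeightedHomogeneous (homogenization u v p) := by
  classical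
  refine ⟨(WeylAlgebra.coeffs p).support.sup (wDeg u v), fun m hm => ?_⟩
  simp only [homogenization, Finsupp.sum, map_sum, map_smul,
    HWeylAlgebra.coeffs_monomial] at hm
  obtain ⟨a, ha, hm⟩ := Finset.mem_biUnion.1 (Finsupp.support_finsetSum hm)
  rw [Finset.mem_singleton.1 (Finsupp.support_single_subset (Finsupp.support_smul hm))]
  -- The exponent of `h` is an untruncated difference, since the supremum dominates the degree of
  -- each monomial in the support.
  exact Nat.add_sub_cancel' (Finset.le_sup (f := wDeg u v) ha)

/-- A weighted homogeneous element has itself and zero as its only components; this settles the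
generators of the homogenized ideal. -/
theorem homogeneousPart_mem_of_isWeightedHomogeneous {J : Ideal (HWeylAlgebra K u v)}
    {f : HWeylAlgebra K u v} (hf : IsWeightedHomogeneous f) (hJ : f ∈ J) (r : ℕ) :
    homogeneousPart r f ∈ J := by
  classical
  obtain ⟨s, hs⟩ := hf
  by_cases hr : s = r
  · have : homogeneousPart r f = f := by
      refine Eq.trans (congrArg HWeylAlgebra.ofCoeffs ?_) (HWeylAlgebra.ofCoeffs_coeffs f)
      exact (Finsupp.filter_eq_self_iff (fun m => hDeg u v m = r) _).2 fun m hm =>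
        (hs m (Finsupp.mem_support_iff.2 hm)).trans hr
    rwa [this]
  · have : homogeneousPart r f = 0 := by
      refine Eq.trans (congrArg HWeylAlgebra.ofCoeffs ?_) (map_zero _)
      refine (Finsupp.filter_eq_zero_iff (fun m => hDeg u v m = r) _).2 fun m hm => ?_
      by_contra h0
      exact hr ((hs m (Finsupp.mem_support_iff.2 h0)).symm.trans hm)
    rw [this]
    exact J.zero_mem

/-- The weighted homogenization of an ideal is a graded ideal. -/
theorem homogeneousPart_mem_homogenizedIdeal (I : Ideal (WeylAlgebra K n))
    {f : HWeylAlgebra K u v} (hf : f ∈ homogenizedIdeal u v I) (r : ℕ) :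
    homogeneousPart r f ∈ homogenizedIdeal u v I := by
  induction hf using Submodule.span_induction generalizing r with
  | mem f hf =>
    refine homogeneousPart_mem_of_isWeightedHomogeneous ?_ (Ideal.subset_span hf) r
    obtain ⟨p, -, rfl⟩ := hf
    exact isWeightedHomogeneous_homogenization p
  | zero => rw [map_zero]; exact Ideal.zero_mem _
  | add f f' _ _ h h' => rw [map_add]; exact Ideal.add_mem _ (h r) (h' r)
  | smul g f _ h => exact homogeneousPart_mul_mem_of_forall g h r

/-! ### Bihomogeneous components of elements of the initial ideal. -/

theorem coeffs_eq_zero_iff {f : HWeylAlgebra K u v} : HWeylAlgebra.coeffs f = 0 ↔ f = 0 := by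
  refine ⟨fun h => ?_, fun h => by rw [h, map_zero]⟩
  rw [← HWeylAlgebra.ofCoeffs_coeffs f, h, map_zero]

open Classical in
theorem coeffs_initialForm (w : Fin n → ℝ) (f : HWeylAlgebra K u v) :
    HWeylAlgebra.coeffs (initialForm w f) = (HWeylAlgebra.coeffs f).filter fun m =>
      ∀ m' ∈ (HWeylAlgebra.coeffs f).support, vWeight w m'.1 ≤ vWeight w m.1 :=
  HWeylAlgebra.coeffs_ofCoeffs _

/-- A bihomogeneous component of an element of the initial ideal of a graded ideal `J` is the
top-weight component of a weighted homogeneous element of `J`. -/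
theorem exists_mem_coeffs_eq_of_mem_initialIdeal (w : Fin n → ℝ)
    {J : Ideal (HWeylAlgebra K u v)} (hJ : ∀ f ∈ J, ∀ r, homogeneousPart r f ∈ J)
    {f : HWeylAlgebra K u v} (hf : f ∈ initialIdeal w J) (r : ℕ) (s : ℝ) :
    ∃ p ∈ J, (∀ m ∈ (HWeylAlgebra.coeffs p).support, hDeg u v m = r ∧ vWeight w m.1 ≤ s) ∧
      ∀ m, hDeg u v m = r → vWeight w m.1 = s →
        HWeylAlgebra.coeffs p m = HWeylAlgebra.coeffs f m := by
  classical
  change f ∈ Submodule.span K (initialForm w '' (J : Set (HWeylAlgebra K u v))) at hf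
  -- The claim bounds the weights of `p` by `s` without requiring `s` to be attained. This makes it
  -- linear in `f`, so it survives cancellation between initial forms.
  induction hf using Submodule.span_induction with
  | mem f hf =>
    obtain ⟨f, hf, rfl⟩ := hf
    -- If `s` is the top weight of `f`, the initial form retains exactly the terms of weight `s`, so
    -- the degree `r` component of `f` serves as `p`.
    by_cases hs : ∃ m ∈ (HWeylAlgebra.coeffs f).support, vWeight w m.1 = s ∧
        ∀ m' ∈ (HWeylAlgebra.coeffs f).support, vWeight w m'.1 ≤ s
    · obtain ⟨-, -, -, hmax⟩ := hs
      refine ⟨homogeneousPart r f, hJ f hf r, fun m hm => ?_, fun m hr hms => ?_⟩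
      · rw [coeffs_homogeneousPart, Finsupp.support_filter, Finset.mem_filter] at hm
        exact ⟨hm.2, hmax m hm.1⟩
      · rw [coeffs_homogeneousPart, coeffs_initialForm, Finsupp.filter_apply,
          if_pos hr, Finsupp.filter_apply, if_pos]
        exact hms ▸ hmax
    -- Otherwise the initial form has no term of weight `s`, and `p = 0` matches it there.
    · refine ⟨0, J.zero_mem, by simp, fun m _ hms => ?_⟩
      rw [map_zero, Finsupp.zero_apply, coeffs_initialForm, Finsupp.filter_apply]
      split_ifs with h
      · by_contra h0
        exact hs ⟨m, Finsupp.mem_support_iff.2 (Ne.symm h0), hms, hms ▸ h⟩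
      · rfl
  | zero => exact ⟨0, J.zero_mem, by simp, by simp⟩
  | add f f' _ _ h h' =>
    obtain ⟨p, hp, h1, h2⟩ := h
    obtain ⟨p', hp', h1', h2'⟩ := h'
    refine ⟨p + p', J.add_mem hp hp', fun m hm => ?_, fun m hr hs => ?_⟩
    · rw [map_add] at hm
      exact (Finset.mem_union.1 (Finsupp.support_add hm)).elim (h1 m) (h1' m)
    · simp [h2 m hr hs, h2' m hr hs]
  | smul a f _ h =>
    obtain ⟨p, hp, h1, h2⟩ := h
    refine ⟨a • p, ?_, fun m hm => ?_, fun m hr hs => ?_⟩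
    · rw [Algebra.smul_def]
      exact J.mul_mem_left _ hp
    · rw [map_smul] at hm
      exact h1 m (Finsupp.support_smul hm)
    · simp [h2 m hr hs]

end WeightedHomogeneousComponents

/-! ## Leading monomials -/

section LeadingMonomials

variable {K : Type*} [Field K] {n : ℕ} {u v : Fin n → ℕ}

/-- The finite support has a maximum for the lexicographic key formed by the weighted degree and the
monomial at `h = 1`. The key determines the monomial, because the exponent of `h` is recovered from
the degree; so the maximum is strict. -/
theorem exists_isLeadingMonomial_homogenizedLT (ord : MonomialOrder (Fin n ⊕ Fin n))
    {f : HWeylAlgebra K u v} (hf : f ≠ 0) :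
    ∃ m, IsLeadingMonomial (HomogenizedLT u v fun a b => ord.toSyn a < ord.toSyn b) f m := by
  have hne : (HWeylAlgebra.coeffs f).support.Nonempty :=
    Finsupp.support_nonempty_iff.2 (coeffs_eq_zero_iff.not.2 hf)
  obtain ⟨m, hm, hmax⟩ := Finset.exists_max_image _
    (fun m : HMon n => toLex (hDeg u v m, ord.toSyn m.1)) hne
  refine ⟨m, hm, fun m' hm' hmm => ?_⟩
  rcases Prod.Lex.le_iff.1 (hmax m' hm') with h | ⟨h, h'⟩
  · exact Or.inl h
  · refine Or.inr ⟨h, lt_of_le_of_ne h' fun h1 => hmm ?_⟩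
    have h2 : m'.1 = m.1 := ord.toSyn.injective h1
    refine Prod.ext h2 ?_
    have h3 : hDeg u v m' = hDeg u v m := h
    simp only [hDeg, h2] at h3
    omega

theorem HomogenizedLT.asymm {w : Fin n → ℝ} {ord : MonomialOrder (Fin n ⊕ Fin n)}
    {a b : HMon n}
    (h : HomogenizedLT u v (WeightLT w fun a b => ord.toSyn a < ord.toSyn b) a b) :
    ¬ HomogenizedLT u v (WeightLT w fun a b => ord.toSyn a < ord.toSyn b) b a := by
  rintro (h1 | ⟨h1, h2 | ⟨h2, h3⟩⟩) <;> rcases h with h4 | ⟨h4, h5 | ⟨h5, h6⟩⟩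
  all_goals first | omega | linarith | exact lt_asymm h3 h6

/-- Asymmetry suffices: two distinct leading monomials would each lie strictly below the other. -/
theorem IsLeadingMonomial.unique {lt : HMon n → HMon n → Prop}
    (hlt : ∀ a b, lt a b → ¬ lt b a) {f : HWeylAlgebra K u v} {a b : HMon n}
    (ha : IsLeadingMonomial lt f a) (hb : IsLeadingMonomial lt f b) : a = b := by
  by_contra h
  exact hlt a b (hb.2 a ha.1 h) (ha.2 b hb.1 (Ne.symm h))

/-- The leading monomial of a weighted homogeneous element with respect to `≺_{(-w,w)}^{(h)}` is
the leading monomial of its initial form with respect to `≺^{(h)}`. -/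
theorem IsLeadingMonomial.initialForm {w : Fin n → ℝ} {lt : WMon n → WMon n → Prop}
    {g : HWeylAlgebra K u v} {a : HMon n} (hg : IsWeightedHomogeneous g)
    (ha : IsLeadingMonomial (HomogenizedLT u v (WeightLT w lt)) g a) :
    IsLeadingMonomial (HomogenizedLT u v lt) (initialForm w g) a := by
  classical
  obtain ⟨r, hr⟩ := hg
  -- All monomials of `g` share the degree `r`, so the degree comparison never decides and weight
  -- followed by `lt` remains.
  have hlt : ∀ m ∈ (HWeylAlgebra.coeffs g).support, m ≠ a → WeightLT w lt m.1 a.1 := by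
    intro m hm hma
    rcases ha.2 m hm hma with h | ⟨-, h⟩
    · rw [hr m hm, hr a ha.1] at h
      exact absurd h (lt_irrefl r)
    · exact h
  simp only [IsLeadingMonomial, coeffs_initialForm, Finsupp.support_filter, Finset.mem_filter]
  refine ⟨⟨ha.1, fun m hm => ?_⟩, fun m hm hma => Or.inr ⟨?_, ?_⟩⟩
  · by_cases hma : m = a
    · rw [hma]
    · rcases hlt m hm hma with h | ⟨h, -⟩
      exacts [h.le, h.le]
  · rw [hr m hm.1, hr a ha.1]
  -- A monomial that survives in the initial form has maximal weight, so it ties with `a` in weight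
  -- and `lt` must decide.
  · rcases hlt m hm.1 hma with h | ⟨-, h⟩
    · exact absurd (hm.2 a ha.1) (not_le.2 h)
    · exact h

end LeadingMonomials

/-! ### The Gröbner basis of the initial ideal. -/

theorem mainTheorem3 {K : Type*} [Field K] [CharZero K] {n : ℕ}
    (u v : Fin n → ℕ) (hu : ∀ i, 0 < u i) (hv : ∀ i, 0 < v i)
    (w : Fin n → ℝ) (hw0 : w ≠ 0) (hw : ∀ i, 0 ≤ w i)
    (I : Ideal (WeylAlgebra K n))
    (ord : MonomialOrder (Fin n ⊕ Fin n))
    (G : Set (HWeylAlgebra K u v))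
    (hGhom : ∀ g ∈ G, IsWeightedHomogeneous g)
    (hG : IsLeftGroebnerBasis
      (HomogenizedLT u v (WeightLT w fun a b => ord.toSyn a < ord.toSyn b))
      (homogenizedIdeal u v I) G) :
    IsLeftGroebnerBasis
      (HomogenizedLT u v fun a b => ord.toSyn a < ord.toSyn b)
      (initialIdeal w (homogenizedIdeal u v I))
      (initialForm w '' G) := by
  refine ⟨?_, fun f hf hf0 => ?_⟩
  · rintro - ⟨g, hg, rfl⟩
    exact Submodule.subset_span (R := K) ⟨g, hG.1 hg, rfl⟩
  obtain ⟨m, hm⟩ := exists_isLeadingMonomial_homogenizedLT ord hf0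
  -- The bidegree is that of the leading monomial `m` of `f`, so `p` inherits the nonzero
  -- coefficient at `m`.
  obtain ⟨p, hp, hsupp, hcoeff⟩ := exists_mem_coeffs_eq_of_mem_initialIdeal w
    (fun f hf r => homogeneousPart_mem_homogenizedIdeal I hf r) hf (hDeg u v m) (vWeight w m.1)
  have hmp : m ∈ (HWeylAlgebra.coeffs p).support := by
    rw [Finsupp.mem_support_iff, hcoeff m rfl rfl]
    exact Finsupp.mem_support_iff.1 hm.1
  have hp0 : p ≠ 0 := by
    rintro rfl
    simp at hmp
  obtain ⟨g, hg, a, b, ha, hb, hab⟩ := hG.2 p hp hp0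
  -- Every monomial of `p` has the degree of `m`. Those of smaller weight lie below `m` by weight;
  -- those of equal weight also occur in `f`, where `m` leads, and with equal degrees that
  -- comparison comes from `ord`.
  have hlead : IsLeadingMonomial
      (HomogenizedLT u v (WeightLT w fun a b => ord.toSyn a < ord.toSyn b)) p m := by
    refine ⟨hmp, fun m' hm' hne => Or.inr ⟨(hsupp m' hm').1, ?_⟩⟩
    rcases (hsupp m' hm').2.lt_or_eq with h | h
    · exact Or.inl h
    · refine Or.inr ⟨h, ?_⟩
      have hm'f : m' ∈ (HWeylAlgebra.coeffs f).support := by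
        rw [Finsupp.mem_support_iff, ← hcoeff m' (hsupp m' hm').1 h]
        exact Finsupp.mem_support_iff.1 hm'
      rcases hm.2 m' hm'f hne with h1 | ⟨-, h1⟩
      · exact absurd (hsupp m' hm').1 h1.ne
      · exact h1
  -- The basis property yields a divisor of some leading monomial `b` of `p`; uniqueness identifies
  -- `b` with `m`.
  rw [hb.unique (fun _ _ => HomogenizedLT.asymm) hlead] at hab
  exact ⟨initialForm w g, ⟨g, hg, rfl⟩, a, m, ha.initialForm (hGhom g hg), hm, hab⟩
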